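/- Let $d_1,d_2,d_3\ge 1$ be integers with $d=d_1d_2d_3>1$, and let $\mathcal H=\mathbb C^{d_1}\otimes\mathbb C^{d_2}\otimes\mathbb C^{d_3}$. For a vector $\psi$ in a bipartite space $\mathcal H_A\otimes\mathcal H_B$ let $$\tau_{A|B}(\psi)=2\Big(1-\mathrm{Tr}_A\big(\mathrm{Tr}_B|\psi\rangle\langle\psi|\big)^2\Big)$$ be the generalized concurrence, and for $\psi\in\mathcal H$ let $\tau_1(\psi)=\frac13\big(\tau_{12|3}(\psi)+\tau_{13|2}(\psi)+\tau_{23|1}(\psi)\big)$ be the one-tangle. For a function $\tau$ on $\mathcal H$ and a unitary gate $U$ on $\mathcal H$ let the entangling power $$\varepsilon_\tau(U)=\big\langle \tau\big(U(\psi_1\otimes\psi_2\otimes\psi_3)\big)\big\rangle_{\psi_1,\psi_2,\psi_3}$$ be the average over independent $\psi_i$, uniformly distributed on the unit spheres of $\mathbb C^{d_i}$. Write $\varepsilon_{12|3}$ for $\varepsilon_{\tau}$ with $\tau=\tau_{12|3}$. Real orthogonal $d\times d$ matrices $O\in O(d)$ act as gates on $\mathcal H$ through the computational product basis, and $\langle\cdot\rangle_{O(d)}$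 denotes the average over $O(d)$ with respect to the normalized Haar measure. Then $$\langle \varepsilon_{\tau_1}(O)\rangle_{O(d)}=\frac{\big(3d+3-d_1-d_2-d_3-d_1d_2-d_1d_3-d_2d_3\big)\big(d\,(d_1+1)(d_2+1)(d_3+1)-8\big)}{\frac32\,(d-1)(d+2)(d_1+1)(d_2+1)(d_3+1)} .$$ Moreover, if $d_1=d_2=d_3$, then $\langle \varepsilon_{\tau_1}(O)\rangle_{O(d)}=\langle \varepsilon_{12|3}(O)\rangle_{O(d)}$. -/

import Mathlib

open MeasureTheory

section States

/-- The density matrix `|ψ⟩⟨ψ|` of a vector written in the computational basis. -/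
def densityMatrix {κ : Type*} (ψ : κ → ℂ) : Matrix κ κ ℂ :=
  Matrix.vecMulVec ψ (star ψ)

/-- The partial trace `Tr_B` over the second factor. -/
def partialTraceRight {α β : Type*} [Fintype β] (M : Matrix (α × β) (α × β) ℂ) :
    Matrix α α ℂ :=
  Matrix.of fun a a' => ∑ b, M (a, b) (a', b)

/-- The generalized concurrence `τ_{A|B}(ψ) = 2 (1 - Tr_A ((Tr_B |ψ⟩⟨ψ|)²))`. The trace of the
square of the Hermitian matrix `Tr_B |ψ⟩⟨ψ|` is real; `.re` only reads it as a real number. -/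
noncomputable def generalizedConcurrence {α β : Type*} [Fintype α] [Fintype β]
    (ψ : α × β → ℂ) : ℝ :=
  2 * (1 - (Matrix.trace
    (partialTraceRight (densityMatrix ψ) * partialTraceRight (densityMatrix ψ))).re)

/-- The basis labels `(i₁, i₂, i₃)` of `ℋ₁ ⊗ ℋ₂ ⊗ ℋ₃` with `dim ℋᵢ = dᵢ`. This set has
`d₁ d₂ d₃` elements. -/
abbrev TriIndex (d₁ d₂ d₃ : ℕ) : Type := Fin d₁ × Fin d₂ × Fin d₃

variable {d₁ d₂ d₃ : ℕ}

/-- The generalized concurrence `τ_{12|3}`. -/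
noncomputable def concurrence12_3 (ψ : TriIndex d₁ d₂ d₃ → ℂ) : ℝ :=
  generalizedConcurrence (α := Fin d₁ × Fin d₂) (β := Fin d₃)
    fun x => ψ (x.1.1, x.1.2, x.2)

/-- The generalized concurrence `τ_{13|2}`. -/
noncomputable def concurrence13_2 (ψ : TriIndex d₁ d₂ d₃ → ℂ) : ℝ :=
  generalizedConcurrence (α := Fin d₁ × Fin d₃) (β := Fin d₂)
    fun x => ψ (x.1.1, x.2, x.1.2)

/-- The generalized concurrence `τ_{23|1}`. -/
noncomputable def concurrence23_1 (ψ : TriIndex d₁ d₂ d₃ → ℂ) : ℝ :=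
  generalizedConcurrence (α := Fin d₂ × Fin d₃) (β := Fin d₁)
    fun x => ψ (x.2, x.1.1, x.1.2)

/-- The one-tangle `τ₁`. -/
noncomputable def oneTangle (ψ : TriIndex d₁ d₂ d₃ → ℂ) : ℝ :=
  (1 / 3) * (concurrence12_3 ψ + concurrence13_2 ψ + concurrence23_1 ψ)

/-- The product vector `ψ₁ ⊗ ψ₂ ⊗ ψ₃` in the computational basis. -/
def productState (ψ₁ : EuclideanSpace ℂ (Fin d₁)) (ψ₂ : EuclideanSpace ℂ (Fin d₂))
    (ψ₃ : EuclideanSpace ℂ (Fin d₃)) : TriIndex d₁ d₂ d₃ → ℂ :=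
  fun i => ψ₁ i.1 * ψ₂ i.2.1 * ψ₃ i.2.2

end States

section EntanglingPower

/-- The uniform probability measure on the unit sphere of `ℂⁿ`: the surface measure induced by
Lebesgue measure, normalized to total mass one. -/
noncomputable def uniformSphere (n : ℕ) :
    Measure (Metric.sphere (0 : EuclideanSpace ℂ (Fin n)) 1) :=
  ((volume : Measure (EuclideanSpace ℂ (Fin n))).toSphere Set.univ)⁻¹ •
    (volume : Measure (EuclideanSpace ℂ (Fin n))).toSphere

/-- The entangling power `ε_τ(U) = ⟨τ(U |ψ_sep⟩)⟩`: the average of the entanglement measure `τ`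
over the images under the gate `U` of `ψ₁ ⊗ ψ₂ ⊗ ψ₃`, where the `ψᵢ` are independent and uniform
on the unit spheres of the three local spaces. -/
noncomputable def entanglingPower {d₁ d₂ d₃ : ℕ} (τ : (TriIndex d₁ d₂ d₃ → ℂ) → ℝ)
    (U : Matrix.unitaryGroup (TriIndex d₁ d₂ d₃) ℂ) : ℝ :=
  ∫ ψ, τ (Matrix.mulVec (U : Matrix (TriIndex d₁ d₂ d₃) (TriIndex d₁ d₂ d₃) ℂ)
      (productState ψ.1.1 ψ.2.1.1 ψ.2.2.1))
    ∂((uniformSphere d₁).prod ((uniformSphere d₂).prod (uniformSphere d₃)))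

end EntanglingPower

section Orthogonal

variable {κ : Type*} [Fintype κ] [DecidableEq κ]

/-- A real orthogonal matrix, regarded as a (complex) unitary gate. -/
def orthogonalGate (O : Matrix.orthogonalGroup κ ℝ) : Matrix.unitaryGroup κ ℂ :=
  ⟨(O : Matrix κ κ ℝ).map Complex.ofReal, by
    have h := (Matrix.mem_orthogonalGroup_iff κ ℝ).1 O.2
    rw [Matrix.mem_unitaryGroup_iff, Matrix.star_eq_conjTranspose]
    have h2 : ((O : Matrix κ κ ℝ).map Complex.ofReal).conjTranspose
        = ((O : Matrix κ κ ℝ).transpose).map Complex.ofReal := by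
      ext i j
      simp
    rw [h2]
    have h3 := congrArg (fun M : Matrix κ κ ℝ => M.map Complex.ofRealHom) h
    rw [Matrix.map_mul, Matrix.map_one _ (map_zero _) (map_one _)] at h3
    exact h3⟩

instance orthogonalGroup_compactSpace : CompactSpace (Matrix.orthogonalGroup κ ℝ) := by
  refine isCompact_iff_compactSpace (s := (Matrix.orthogonalGroup κ ℝ : Set (Matrix κ κ ℝ))).1 ?_
  have hK : IsCompact (Set.pi Set.univ fun _ : κ => Set.pi Set.univ fun _ : κ =>
      Set.Icc (-1 : ℝ) 1) :=
    isCompact_univ_pi fun _ => isCompact_univ_pi fun _ => isCompact_Icc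
  refine IsCompact.of_isClosed_subset hK (isClosed_unitary (R := Matrix κ κ ℝ)) ?_
  intro M hM i _ j _
  have h := entry_norm_bound_of_unitary (𝕜 := ℝ) (U := M) hM i j
  rw [Real.norm_eq_abs] at h
  exact abs_le.1 h

instance orthogonalGroup_measurableSpace : MeasurableSpace (Matrix.orthogonalGroup κ ℝ) :=
  borel _

instance orthogonalGroup_borelSpace : BorelSpace (Matrix.orthogonalGroup κ ℝ) := ⟨rfl⟩

/-- The Haar measure on the orthogonal group, normalized to total mass one. -/
noncomputable def haarOrthogonal (κ : Type*) [Fintype κ] [DecidableEq κ] :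
    Measure (Matrix.orthogonalGroup κ ℝ) :=
  Measure.haarMeasure ⊤

end Orthogonal

/-- The average `⟨ε_τ(O)⟩` over Haar-random gates `O` in `O(d₁ d₂ d₃)`. -/
noncomputable def averageEntanglingPower {d₁ d₂ d₃ : ℕ} (τ : (TriIndex d₁ d₂ d₃ → ℂ) → ℝ) : ℝ :=
  ∫ O, entanglingPower τ (orthogonalGate O) ∂(haarOrthogonal (TriIndex d₁ d₂ d₃))

/-! By Fubini, fix a product state `ψ` and average over `O` first. The purity of a reduced state of
`φ = Oψ` is a sum of fourth moments `⟨φ_i φ̄_j φ_k φ̄_l⟩`. Left invariance of Haar measure makes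
these an `O(d)`-invariant tensor, symmetric in `i` and `k`. By `IsOrthogonalInvariant.exists_eq` the
tensor equals `A (δ_ij δ_kl + δ_il δ_jk) + B δ_ik δ_jl`.

Two contractions give equations for `A` and `B`: the norm `φ·φ̄ = 1`, and the bilinear square `φ·φ =
ψ·ψ`, which real orthogonal matrices also preserve. For a bipartition with local dimensions `a`, `b`
the mean purity is `d (A (a + b) + B)`, so the mean concurrence is affine in `|ψ·ψ|²`
(`integral_generalizedConcurrence_haarOrthogonal`).

On product states `|ψ·ψ|²` factorizes. The same tensor theorem on each sphere, with phase invariance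
forcing `B = 0` when `n > 1`, gives each factor the mean `2 / (dᵢ + 1)`
(`integral_square_uniformSphere`). Averaging the three bipartitions yields the formula. -/

theorem exists_perm_apply_eq {κ : Type*} [DecidableEq κ] {p q i k : κ} (hpq : p ≠ q) (hik : i ≠ k) :
    ∃ σ : Equiv.Perm κ, σ p = i ∧ σ q = k := by
  refine ⟨(Equiv.swap p i).trans (Equiv.swap (Equiv.swap p i q) k), ?_, by simp⟩
  rw [Equiv.trans_apply, Equiv.swap_apply_left, Equiv.swap_apply_of_ne_of_ne _ hik]
  intro h
  apply hpq
  exact (Equiv.swap p i).injective ((Equiv.swap_apply_left p i).trans h)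

/-! ### Orthogonally invariant tensors of degree four. -/

section InvariantTensor

variable {κ : Type*} [Fintype κ] [DecidableEq κ]

/-- A four-index tensor on `ℝ^κ` that is invariant under the orthogonal group. -/
def IsOrthogonalInvariant (T : κ → κ → κ → κ → ℂ) : Prop :=
  ∀ R ∈ Matrix.orthogonalGroup κ ℝ, ∀ i j k l, T i j k l =
    ∑ x, ∑ y, ∑ z, ∑ w, ((R i x : ℂ) * R j y * R k z * R l w) * T x y z w

/-- The reflection `1 - c v vᵀ` with `c (v ⬝ᵥ v) = 2` is orthogonal. -/
theorem one_sub_vecMulVec_mem_orthogonalGroup (c : ℝ) (v : κ → ℝ) (h : c * (v ⬝ᵥ v) = 2) :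
    1 - c • Matrix.vecMulVec v v ∈ Matrix.orthogonalGroup κ ℝ := by
  rw [Matrix.mem_orthogonalGroup_iff]
  have ht : (1 - c • Matrix.vecMulVec v v).transpose = 1 - c • Matrix.vecMulVec v v := by
    ext i j
    simp [Matrix.vecMulVec_apply, Matrix.one_apply, eq_comm, mul_comm]
  rw [ht, sub_mul, mul_sub, mul_sub, smul_mul_smul_comm, Matrix.vecMulVec_mul_vecMulVec]
  have h2 : (c * c) • Matrix.vecMulVec v ((v ⬝ᵥ v) • v) = (2 : ℝ) • (c • Matrix.vecMulVec v v) := by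
    rw [Matrix.vecMulVec_smul, smul_smul, smul_smul, ← h]
    ring_nf
  rw [h2, two_smul]
  simp

theorem permMatrix_mem_orthogonalGroup (σ : Equiv.Perm κ) :
    σ.permMatrix ℝ ∈ Matrix.orthogonalGroup κ ℝ := by
  rw [Matrix.mem_orthogonalGroup_iff, Matrix.transpose_permMatrix, ← Matrix.permMatrix_mul]
  simp

theorem diagonal_sign_mem_orthogonalGroup (p : κ) :
    Matrix.diagonal (fun x => if x = p then (-1 : ℝ) else 1) ∈ Matrix.orthogonalGroup κ ℝ := by
  rw [Matrix.mem_orthogonalGroup_iff, Matrix.diagonal_transpose,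
    Matrix.diagonal_mul_diagonal, ← Matrix.diagonal_one]
  congr 1
  ext x
  split_ifs <;> simp

theorem IsOrthogonalInvariant.perm {T : κ → κ → κ → κ → ℂ} (hT : IsOrthogonalInvariant T)
    (σ : Equiv.Perm κ) (i j k l : κ) : T (σ i) (σ j) (σ k) (σ l) = T i j k l := by
  rw [hT _ (permMatrix_mem_orthogonalGroup σ) i j k l]
  simp [Equiv.Perm.permMatrix, PEquiv.toMatrix_apply, apply_ite Complex.ofReal, ite_mul]

theorem IsOrthogonalInvariant.sign {T : κ → κ → κ → κ → ℂ} (hT : IsOrthogonalInvariant T)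
    (p i j k l : κ) : T i j k l =
      (if i = p then -1 else 1) * (if j = p then -1 else 1) * (if k = p then -1 else 1) *
        (if l = p then -1 else 1) * T i j k l := by
  conv_lhs => rw [hT _ (diagonal_sign_mem_orthogonalGroup p) i j k l]
  simp [Matrix.diagonal_apply, ite_mul, mul_ite, apply_ite Complex.ofReal]

/-- Permutations and sign changes do not relate the diagonal entry to the paired ones; a reflection
mixing `p` and `q` does. Entries with an odd number of `p`s vanish by sign changes, and exchanging
`p` and `q` identifies the rest in pairs. -/
theorem IsOrthogonalInvariant.rotation {T : κ → κ → κ → κ → ℂ} (hT : IsOrthogonalInvariant T)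
    {p q : κ} (hpq : p ≠ q) : T p p p p = T p p q q + T p q p q + T p q q p := by
  have hqp := hpq.symm
  -- The triple 3, 4, 5: row `p` of this reflection is `(3/5, -4/5)` in the `p, q` plane, so all
  -- coefficients are rational.
  set v : κ → ℝ := Pi.single p 1 + Pi.single q 2 with hv
  have hvv : (2 / 5 : ℝ) * (v ⬝ᵥ v) = 2 := by
    simp [hv, hpq, hqp]
    norm_num
  have key := hT _ (one_sub_vecMulVec_mem_orthogonalGroup _ v hvv) p p p p
  have hR : ∀ x, (((1 - (2 / 5 : ℝ) • Matrix.vecMulVec v v) p x : ℝ) : ℂ) =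
      (if p = x then (3 / 5 : ℂ) else 0) + (if q = x then (-4 / 5 : ℂ) else 0) := by
    intro x
    by_cases hx : p = x
    · subst hx
      simp [hv, Matrix.vecMulVec_apply, hpq, hqp]
      norm_num
    · by_cases hx' : q = x
      · subst hx'
        simp [hv, Matrix.vecMulVec_apply, hpq, hqp]
        norm_num
      · simp [hv, Matrix.vecMulVec_apply, hpq, hx, hx', Ne.symm hx, Ne.symm hx']
  simp only [hR, add_mul, mul_add, Finset.sum_add_distrib, ite_mul, mul_ite, zero_mul, mul_zero,
    Finset.sum_ite_eq, Finset.mem_univ, if_true] at key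
  have z : ∀ {t : ℂ}, t = -t → t = 0 := fun h => self_eq_neg.1 h
  have h1 : T p p p q = 0 := z (by simpa [hpq, hqp] using hT.sign q p p p q)
  have h2 : T p p q p = 0 := z (by simpa [hpq, hqp] using hT.sign q p p q p)
  have h3 : T p q p p = 0 := z (by simpa [hpq, hqp] using hT.sign q p q p p)
  have h4 : T q p p p = 0 := z (by simpa [hpq, hqp] using hT.sign q q p p p)
  have h5 : T q q q p = 0 := z (by simpa [hpq, hqp] using hT.sign p q q q p)
  have h6 : T q q p q = 0 := z (by simpa [hpq, hqp] using hT.sign p q q p q)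
  have h7 : T q p q q = 0 := z (by simpa [hpq, hqp] using hT.sign p q p q q)
  have h8 : T p q q q = 0 := z (by simpa [hpq, hqp] using hT.sign p p q q q)
  have e1 : T q q q q = T p p p p := by simpa using hT.perm (Equiv.swap p q) p p p p
  have e2 : T q q p p = T p p q q := by simpa using hT.perm (Equiv.swap p q) p p q q
  have e3 : T q p q p = T p q p q := by simpa using hT.perm (Equiv.swap p q) p q p q
  have e4 : T q p p q = T p q q p := by simpa using hT.perm (Equiv.swap p q) p q q p
  rw [h1, h2, h3, h4, h5, h6, h7, h8, e1, e2, e3, e4] at key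
  -- Both `1 - (3⁴ + 4⁴)/5⁴` and `2 · 3² · 4²/5⁴` equal `288/625`.
  linear_combination (625 / 288) * key

/-- The first fundamental theorem for `O(κ)` in degree four, for tensors that are symmetric
in the first and the third index. -/
theorem IsOrthogonalInvariant.exists_eq {T : κ → κ → κ → κ → ℂ} (hT : IsOrthogonalInvariant T)
    (hs : ∀ i j k l, T i j k l = T k j i l) : ∃ A B : ℂ, ∀ i j k l, T i j k l =
      A * (if i = j then (if k = l then 1 else 0) else 0) +
      B * (if i = k then (if j = l then 1 else 0) else 0) +
      A * (if i = l then (if j = k then 1 else 0) else 0) := by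
  have z : ∀ {t : ℂ}, t = -t → t = 0 := fun h => self_eq_neg.1 h
  rcases subsingleton_or_nontrivial κ with hκ | hκ
  · rcases isEmpty_or_nonempty κ with he | ⟨⟨p⟩⟩
    · exact ⟨0, 0, fun i => he.elim i⟩
    -- With one index the three delta patterns coincide, so only `2A + B` matters.
    · refine ⟨0, T p p p p, fun i j k l => ?_⟩
      simp [Subsingleton.elim i p, Subsingleton.elim j p, Subsingleton.elim k p,
        Subsingleton.elim l p]
  · obtain ⟨p, q, hpq⟩ := exists_pair_ne κ
    have hA : ∀ i k, i ≠ k → T i i k k = T p p q q := by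
      intro i k hik
      obtain ⟨σ, rfl, rfl⟩ := exists_perm_apply_eq hpq hik
      exact hT.perm σ p p q q
    have hB : ∀ i k, i ≠ k → T i k i k = T p q p q := by
      intro i k hik
      obtain ⟨σ, rfl, rfl⟩ := exists_perm_apply_eq hpq hik
      exact hT.perm σ p q p q
    -- The symmetry in the first and third index identifies two pairings, leaving two free
    -- constants.
    have hC : ∀ i k, i ≠ k → T i k k i = T p p q q := fun i k hik => by
      rw [hs, hA k i hik.symm]
    have hD : ∀ i, T i i i i = T p p q q + T p q p q + T p p q q := by
      intro i
      obtain ⟨k, hk⟩ := exists_ne i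
      rw [hT.rotation hk.symm, hA i k hk.symm, hB i k hk.symm, hC i k hk.symm]
    refine ⟨T p p q q, T p q p q, fun i j k l => ?_⟩
    -- Index patterns without a pairing contain an index that occurs exactly once; flipping its sign
    -- kills the entry.
    by_cases hij : i = j
    · subst hij
      by_cases hkl : k = l
      · subst hkl
        by_cases hik : i = k
        · subst hik
          simp [hD]
        · simp [hik, hA i k hik]
      · by_cases hik : i = k
        · subst hik
          simpa [hkl, Ne.symm hkl] using z (by simpa [hkl, Ne.symm hkl] using hT.sign l i i i l)
        · simpa [hkl, hik] using
            z (by simpa [hkl, Ne.symm hkl, hik, Ne.symm hik] using hT.sign k i i k l)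
    · by_cases hik : i = k
      · subst hik
        by_cases hjl : j = l
        · subst hjl
          simp [hij, hB i j hij]
        · simpa [hjl, hij, Ne.symm hij] using
            z (by simpa [hij, Ne.symm hij, hjl, Ne.symm hjl] using hT.sign j i j i l)
      · by_cases hil : i = l
        · subst hil
          by_cases hjk : j = k
          · subst hjk
            simp [hij, hC i j hij]
          · simpa [hjk, hij, hik] using
              z (by simpa [hij, Ne.symm hij, hjk, Ne.symm hjk] using hT.sign j i j k i)
        · simpa [hil, hij, hik] using
            z (by simpa [hij, Ne.symm hij, hik, Ne.symm hik, hil, Ne.symm hil]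
              using hT.sign i i j k l)

end InvariantTensor

/-! ### Isometry invariance of the uniform measure on the sphere. -/

section Sphere

open Metric in
/-- The action of a linear isometry on the unit sphere. -/
def sphereMap {E : Type*} [NormedAddCommGroup E] [NormedSpace ℝ E] (L : E ≃ₗᵢ[ℝ] E) :
    sphere (0 : E) 1 → sphere (0 : E) 1 :=
  fun x => ⟨L x, by simp⟩

-- The surface measure of `s` is, up to a dimensional constant, the volume of the cone `(0,1) • s`.
-- A linear isometry carries cones to cones and preserves volume.
open Metric Pointwise in
theorem measurePreserving_sphereMap {E : Type*} [NormedAddCommGroup E] [InnerProductSpace ℝ E]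
    [FiniteDimensional ℝ E] [MeasurableSpace E] [BorelSpace E] (L : E ≃ₗᵢ[ℝ] E) :
    MeasurePreserving (sphereMap L) (volume : Measure E).toSphere (volume : Measure E).toSphere := by
  have hm : Measurable (sphereMap L) :=
    (L.continuous.measurable.comp measurable_subtype_coe).subtype_mk
  refine ⟨hm, Measure.ext fun s hs => ?_⟩
  rw [Measure.map_apply hm hs, Measure.toSphere_apply' _ (hm hs), Measure.toSphere_apply' _ hs]
  congr 1
  have he : Set.Ioo (0 : ℝ) 1 • (Subtype.val '' (sphereMap L ⁻¹' s)) =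
      L ⁻¹' (Set.Ioo (0 : ℝ) 1 • (Subtype.val '' s)) := by
    ext x
    simp only [Set.mem_smul, Set.mem_image, Set.mem_preimage]
    constructor
    · rintro ⟨r, hr, _, ⟨y, hy, rfl⟩, rfl⟩
      exact ⟨r, hr, _, ⟨_, hy, rfl⟩, by simp [sphereMap]⟩
    · rintro ⟨r, hr, _, ⟨y, hy, rfl⟩, h⟩
      refine ⟨r, hr, _, ⟨sphereMap L.symm y, ?_, rfl⟩, ?_⟩
      · simpa [sphereMap] using hy
      · apply L.injective
        simpa [sphereMap] using h
  rw [he]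
  exact L.measurePreserving.measure_preimage_emb L.toHomeomorph.measurableEmbedding _

theorem integral_sphereMap_uniformSphere {n : ℕ}
    (L : EuclideanSpace ℂ (Fin n) ≃ₗᵢ[ℝ] EuclideanSpace ℂ (Fin n))
    (f : Metric.sphere (0 : EuclideanSpace ℂ (Fin n)) 1 → ℂ) (hf : Continuous f) :
    ∫ x, f (sphereMap L x) ∂uniformSphere n = ∫ x, f x ∂uniformSphere n := by
  unfold uniformSphere
  rw [integral_smul_measure, integral_smul_measure]
  congr 1
  have h := measurePreserving_sphereMap L
  rw [← integral_map h.measurable.aemeasurable, h.map_eq]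
  rw [h.map_eq]
  exact hf.aestronglyMeasurable

instance uniformSphere_isProbabilityMeasure (n : ℕ) [NeZero n] :
    IsProbabilityMeasure (uniformSphere n) := by
  constructor
  have : Nontrivial (EuclideanSpace ℂ (Fin n)) := inferInstance
  have h := (Measure.toSphere_ne_zero (volume : Measure (EuclideanSpace ℂ (Fin n))))
  rw [uniformSphere, Measure.smul_apply, smul_eq_mul, ENNReal.inv_mul_cancel]
  · exact Measure.measure_univ_ne_zero.2 h
  · exact measure_ne_top _ _

/-- The isometry of `ℂⁿ` given by a unitary matrix. -/
noncomputable def unitaryIsometry {n : ℕ} (U : Matrix.unitaryGroup (Fin n) ℂ) :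
    EuclideanSpace ℂ (Fin n) ≃ₗᵢ[ℝ] EuclideanSpace ℂ (Fin n) :=
  let L := Unitary.linearIsometryEquiv (H := EuclideanSpace ℂ (Fin n)) (𝕜 := ℂ)
    ⟨Matrix.toEuclideanCLM (n := Fin n) (𝕜 := ℂ) U, Unitary.mem_iff.2 (by
      rw [← map_star, ← map_mul, ← map_mul, (Unitary.mem_iff.1 U.2).1,
        (Unitary.mem_iff.1 U.2).2, map_one]
      exact ⟨rfl, rfl⟩)⟩
  { L.toLinearEquiv.restrictScalars ℝ with norm_map' := L.norm_map }

theorem unitaryIsometry_apply {n : ℕ} (U : Matrix.unitaryGroup (Fin n) ℂ)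
    (x : EuclideanSpace ℂ (Fin n)) :
    (unitaryIsometry U x).ofLp = (U : Matrix (Fin n) (Fin n) ℂ).mulVec x.ofLp :=
  Matrix.ofLp_toEuclideanCLM (U : Matrix (Fin n) (Fin n) ℂ) x

end Sphere

/-! ### Fourth moments of random vectors and their two contractions. -/

section Moments

variable {κ : Type*} [Fintype κ] {Ω : Type*} [MeasurableSpace Ω]

/-- The fourth moments `⟨φ_i φ̄_j φ_k φ̄_l⟩` of a random vector. -/
noncomputable def quarticMoment (μ : Measure Ω) (φ : Ω → κ → ℂ) (i j k l : κ) : ℂ :=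
  ∫ ω, φ ω i * star (φ ω j) * φ ω k * star (φ ω l) ∂μ

theorem sum_mul_sum_mul_sum_mul_sum {κ R : Type*} [Fintype κ] [CommSemiring R] (a b c d : κ → R) :
    (∑ x, a x) * (∑ y, b y) * (∑ z, c z) * (∑ w, d w) =
      ∑ x, ∑ y, ∑ z, ∑ w, a x * b y * c z * d w := by
  simp only [← Finset.mul_sum, ← Finset.sum_mul]

variable [TopologicalSpace Ω] [CompactSpace Ω] [OpensMeasurableSpace Ω]

theorem integrable_of_continuous_compactSpace {E : Type*} [NormedAddCommGroup E] (μ : Measure Ω)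
    [IsFiniteMeasure μ] {f : Ω → E} (hf : Continuous f) : Integrable f μ :=
  hf.integrable_of_hasCompactSupport (HasCompactSupport.of_compactSpace f)

/-- Each coordinate of `Rφ` is expanded linearly. Since `R` is real, conjugation leaves its entries
alone, so all four slots transform by the same matrix. -/
theorem isOrthogonalInvariant_quarticMoment [DecidableEq κ] (μ : Measure Ω) [IsFiniteMeasure μ]
    {φ : Ω → κ → ℂ} (hφ : Continuous φ)
    (hinv : ∀ R ∈ Matrix.orthogonalGroup κ ℝ, ∀ f : (κ → ℂ) → ℂ, Continuous f →
      ∫ ω, f ((R.map Complex.ofReal).mulVec (φ ω)) ∂μ = ∫ ω, f (φ ω) ∂μ) :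
    IsOrthogonalInvariant (quarticMoment μ φ) := by
  intro R hR i j k l
  have hc : ∀ i, Continuous fun ω => φ ω i := fun i => (continuous_apply i).comp hφ
  rw [quarticMoment, ← hinv R hR (fun v => v i * star (v j) * v k * star (v l)) (by fun_prop)]
  have hexp : ∀ ω, (fun v : κ → ℂ => v i * star (v j) * v k * star (v l))
      ((R.map Complex.ofReal).mulVec (φ ω)) = ∑ x, ∑ y, ∑ z, ∑ w,
        ((R i x : ℂ) * R j y * R k z * R l w) *
          (φ ω x * star (φ ω y) * φ ω z * star (φ ω w)) := by
    intro ω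
    simp only [Matrix.mulVec, dotProduct, Matrix.map_apply, star_sum, star_mul', Complex.star_def,
      Complex.conj_ofReal]
    rw [sum_mul_sum_mul_sum_mul_sum]
    refine Finset.sum_congr rfl fun x _ => Finset.sum_congr rfl fun y _ =>
      Finset.sum_congr rfl fun z _ => Finset.sum_congr rfl fun w _ => ?_
    ring
  simp only [hexp, quarticMoment]
  rw [integral_finsetSum _ fun _ _ => integrable_of_continuous_compactSpace μ (by fun_prop)]
  refine Finset.sum_congr rfl fun x _ => ?_
  rw [integral_finsetSum _ fun _ _ => integrable_of_continuous_compactSpace μ (by fun_prop)]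
  refine Finset.sum_congr rfl fun y _ => ?_
  rw [integral_finsetSum _ fun _ _ => integrable_of_continuous_compactSpace μ (by fun_prop)]
  refine Finset.sum_congr rfl fun z _ => ?_
  rw [integral_finsetSum _ fun _ _ => integrable_of_continuous_compactSpace μ (by fun_prop)]
  refine Finset.sum_congr rfl fun w _ => ?_
  rw [integral_const_mul]

theorem sum_quarticMoment_norm (μ : Measure Ω) [IsProbabilityMeasure μ]
    {φ : Ω → κ → ℂ} (hφ : Continuous φ) (h1 : ∀ ω, φ ω ⬝ᵥ star (φ ω) = 1) :
    ∑ i, ∑ j, quarticMoment μ φ i i j j = 1 := by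
  have hc : ∀ i, Continuous fun ω => φ ω i := fun i => (continuous_apply i).comp hφ
  simp only [quarticMoment]
  have : ∀ i, ∑ j, ∫ ω, φ ω i * star (φ ω i) * φ ω j * star (φ ω j) ∂μ =
      ∫ ω, φ ω i * star (φ ω i) ∂μ := by
    intro i
    rw [← integral_finsetSum _ fun _ _ => integrable_of_continuous_compactSpace μ (by fun_prop)]
    congr 1
    ext ω
    have := h1 ω
    simp only [dotProduct, Pi.star_apply] at this
    simp_rw [mul_assoc]
    rw [← Finset.mul_sum, ← Finset.mul_sum, this, mul_one]
  simp only [this]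
  rw [← integral_finsetSum _ fun _ _ => integrable_of_continuous_compactSpace μ (by fun_prop)]
  have h1' : ∀ ω, ∑ i, φ ω i * star (φ ω i) = 1 := h1
  simp only [h1', integral_const, probReal_univ, one_smul]

theorem sum_quarticMoment_square (μ : Measure Ω) [IsFiniteMeasure μ]
    {φ : Ω → κ → ℂ} (hφ : Continuous φ) :
    ∑ i, ∑ j, quarticMoment μ φ i j i j =
      ∫ ω, (φ ω ⬝ᵥ φ ω) * star (φ ω ⬝ᵥ φ ω) ∂μ := by
  have hc : ∀ i, Continuous fun ω => φ ω i := fun i => (continuous_apply i).comp hφ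
  simp only [quarticMoment]
  have (i : κ) : ∑ j, ∫ ω, φ ω i * star (φ ω j) * φ ω i * star (φ ω j) ∂μ =
      ∫ ω, ∑ j, φ ω i * star (φ ω j) * φ ω i * star (φ ω j) ∂μ :=
    (integral_finsetSum _ fun _ _ => integrable_of_continuous_compactSpace μ (by fun_prop)).symm
  simp only [this]
  rw [← integral_finsetSum _ fun _ _ => integrable_of_continuous_compactSpace μ (by fun_prop)]
  congr 1
  ext ω
  simp only [dotProduct, star_sum, Finset.sum_mul_sum, star_mul']
  refine Finset.sum_congr rfl fun i _ => Finset.sum_congr rfl fun j _ => ?_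
  ring

end Moments

/-! ### The mean of the bilinear square on a complex sphere. -/

section SphereMoment

theorem sphere_dotProduct_star {n : ℕ} (x : Metric.sphere (0 : EuclideanSpace ℂ (Fin n)) 1) :
    x.1.ofLp ⬝ᵥ star x.1.ofLp = 1 := by
  have h := EuclideanSpace.norm_sq_eq x.1
  have hx : ‖x.1‖ = 1 := by simp
  rw [hx] at h
  simp only [dotProduct, Pi.star_apply, Complex.star_def, Complex.mul_conj, Complex.normSq_eq_norm_sq]
  exact_mod_cast h.symm.trans (by norm_num)

theorem continuous_sphere_ofLp {n : ℕ} :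
    Continuous fun x : Metric.sphere (0 : EuclideanSpace ℂ (Fin n)) 1 => x.1.ofLp :=
  (PiLp.continuous_ofLp 2 _).comp continuous_subtype_val

theorem integral_mulVec_uniformSphere {n : ℕ} (U : Matrix.unitaryGroup (Fin n) ℂ)
    (f : (Fin n → ℂ) → ℂ) (hf : Continuous f) :
    ∫ x, f ((U : Matrix (Fin n) (Fin n) ℂ).mulVec x.1.ofLp) ∂uniformSphere n =
      ∫ x, f x.1.ofLp ∂uniformSphere n := by
  rw [← integral_sphereMap_uniformSphere (unitaryIsometry U) (fun x => f x.1.ofLp)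
    (hf.comp continuous_sphere_ofLp)]
  simp only [sphereMap, unitaryIsometry_apply]

theorem isOrthogonalInvariant_uniformSphere (n : ℕ) [NeZero n] :
    IsOrthogonalInvariant (quarticMoment (uniformSphere n) fun x => x.1.ofLp) :=
  isOrthogonalInvariant_quarticMoment _ continuous_sphere_ofLp fun R hR f hf =>
    integral_mulVec_uniformSphere (orthogonalGate ⟨R, hR⟩) f hf

theorem quarticMoment_swap {κ Ω : Type*} [MeasurableSpace Ω] (μ : Measure Ω) (φ : Ω → κ → ℂ)
    (i j k l : κ) : quarticMoment μ φ i j k l = quarticMoment μ φ k j i l := by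
  simp only [quarticMoment]
  congr 1
  ext ω
  ring

/-- Multiplying the coordinate `p` by `I` preserves the measure but multiplies the moment by `I² =
-1`. -/
theorem quarticMoment_uniformSphere_eq_zero {n : ℕ} {p q : Fin n} (hpq : p ≠ q) :
    quarticMoment (uniformSphere n) (fun x => x.1.ofLp) p q p q = 0 := by
  have hU : Matrix.diagonal (fun x => if x = p then Complex.I else 1) ∈
      Matrix.unitaryGroup (Fin n) ℂ := by
    rw [Matrix.mem_unitaryGroup_iff, Matrix.star_eq_conjTranspose, Matrix.diagonal_conjTranspose,
      Matrix.diagonal_mul_diagonal, ← Matrix.diagonal_one]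
    congr 1
    ext x
    simp only [Pi.star_apply]
    split_ifs <;> simp
  have h := integral_mulVec_uniformSphere ⟨_, hU⟩
    (fun v => v p * star (v q) * v p * star (v q)) (by fun_prop)
  have e : ∀ a b : ℂ, Complex.I * a * b * (Complex.I * a) * b = -(a * b * a * b) := fun a b => by
    linear_combination (a * b * a * b) * Complex.I_mul_I
  simp only [Matrix.mulVec_diagonal, if_true, if_neg hpq.symm, one_mul, e, integral_neg] at h
  exact self_eq_neg.1 h.symm

/-- `⟨|∑ zᵢ²|²⟩ = 2 / (n + 1)` on the unit sphere of `ℂⁿ`. -/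
theorem integral_square_uniformSphere (n : ℕ) [NeZero n] :
    ∫ x, (x.1.ofLp ⬝ᵥ x.1.ofLp) * star (x.1.ofLp ⬝ᵥ x.1.ofLp) ∂uniformSphere n =
      (2 : ℂ) / (n + 1) := by
  obtain ⟨A, B, h⟩ := (isOrthogonalInvariant_uniformSphere n).exists_eq (quarticMoment_swap _ _)
  have h1 := sum_quarticMoment_norm (uniformSphere n) continuous_sphere_ofLp sphere_dotProduct_star
  rw [← sum_quarticMoment_square (uniformSphere n) continuous_sphere_ofLp]
  simp only [h] at h1 ⊢
  simp [Finset.sum_add_distrib] at h1 ⊢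
  have hn : (n : ℂ) + 1 ≠ 0 := by exact_mod_cast n.succ_ne_zero
  rw [eq_div_iff hn]
  -- For `n = 1` there is no pair of distinct indices to show `B = 0`, but the normalization alone
  -- already determines the sum.
  rcases (NeZero.one_le : 1 ≤ n).eq_or_lt with rfl | hn1
  · push_cast at h1 ⊢
    linear_combination 2 * h1
  · have hB := h ⟨0, by omega⟩ ⟨1, hn1⟩ ⟨0, by omega⟩ ⟨1, hn1⟩
    rw [quarticMoment_uniformSphere_eq_zero (by simp)] at hB
    have hB0 : B = 0 := by simpa using hB.symm
    subst hB0
    linear_combination 2 * h1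

end SphereMoment

/-! ### Haar average of the concurrence for a fixed state. -/

section OrthogonalAverage

variable {κ : Type*} [Fintype κ] [DecidableEq κ]

instance haarOrthogonal_isProbabilityMeasure : IsProbabilityMeasure (haarOrthogonal κ) :=
  ⟨by simpa [haarOrthogonal] using
    Measure.haarMeasure_self (K₀ := (⊤ : TopologicalSpace.PositiveCompacts (Matrix.orthogonalGroup κ ℝ)))⟩

instance haarOrthogonal_isMulLeftInvariant : (haarOrthogonal κ).IsMulLeftInvariant :=
  inferInstanceAs (Measure.haarMeasure _).IsMulLeftInvariant

theorem continuous_orthogonalGate :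
    Continuous fun O : Matrix.orthogonalGroup κ ℝ => (orthogonalGate O : Matrix κ κ ℂ) :=
  continuous_subtype_val.matrix_map Complex.continuous_ofReal

theorem continuous_orthogonalGate_mulVec (ψ : κ → ℂ) :
    Continuous fun O : Matrix.orthogonalGroup κ ℝ =>
      (orthogonalGate O : Matrix κ κ ℂ).mulVec ψ :=
  continuous_orthogonalGate.matrix_mulVec continuous_const

theorem isOrthogonalInvariant_haarOrthogonal (ψ : κ → ℂ) :
    IsOrthogonalInvariant (quarticMoment (haarOrthogonal κ)
      fun O => (orthogonalGate O : Matrix κ κ ℂ).mulVec ψ) := by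
  refine isOrthogonalInvariant_quarticMoment _ (continuous_orthogonalGate_mulVec ψ) ?_
  intro R hR f hf
  refine Eq.trans ?_ (integral_mul_left_eq_self
    (fun O => f ((orthogonalGate O : Matrix κ κ ℂ).mulVec ψ)) (⟨R, hR⟩ : Matrix.orthogonalGroup κ ℝ))
  congr 1
  ext O
  rw [Matrix.mulVec_mulVec]
  congr 2
  exact (Matrix.map_mul (f := Complex.ofRealHom) (L := R)
    (M := (O : Matrix κ κ ℝ))).symm

/-- The bilinear form, taken without conjugation, is preserved because `OᵀO = 1`. A general unitary
does not preserve it, and through it the average depends on `ψ`. -/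
theorem orthogonalGate_mulVec_dotProduct (O : Matrix.orthogonalGroup κ ℝ) (ψ : κ → ℂ) :
    (orthogonalGate O : Matrix κ κ ℂ).mulVec ψ ⬝ᵥ (orthogonalGate O : Matrix κ κ ℂ).mulVec ψ =
      ψ ⬝ᵥ ψ := by
  have h : ((orthogonalGate O : Matrix κ κ ℂ).transpose * (orthogonalGate O : Matrix κ κ ℂ)) =
      1 := by
    have h3 := congrArg (fun M : Matrix κ κ ℝ => M.map Complex.ofRealHom)
      ((Matrix.mem_orthogonalGroup_iff' κ ℝ).1 O.2)
    rw [Matrix.map_mul, Matrix.map_one _ (map_zero _) (map_one _)] at h3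
    exact h3
  rw [Matrix.dotProduct_mulVec, ← Matrix.mulVec_transpose, Matrix.mulVec_mulVec, h,
    Matrix.one_mulVec]

theorem unitary_mulVec_dotProduct_star (U : Matrix.unitaryGroup κ ℂ) (ψ : κ → ℂ) :
    (U : Matrix κ κ ℂ).mulVec ψ ⬝ᵥ star ((U : Matrix κ κ ℂ).mulVec ψ) = ψ ⬝ᵥ star ψ := by
  rw [Matrix.star_mulVec, dotProduct_comm, ← Matrix.dotProduct_mulVec, Matrix.mulVec_mulVec,
    ← Matrix.star_eq_conjTranspose, (Unitary.mem_iff.1 U.2).1, Matrix.one_mulVec, dotProduct_comm]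

theorem generalizedConcurrence_eq {α β : Type*} [Fintype α] [Fintype β] (ψ : α × β → ℂ) :
    generalizedConcurrence ψ = 2 * (1 - (∑ a, ∑ a', ∑ b, ∑ b',
      ψ (a, b) * star (ψ (a', b)) * ψ (a', b') * star (ψ (a, b'))).re) := by
  simp only [generalizedConcurrence, Matrix.trace, Matrix.diag_apply, Matrix.mul_apply,
    partialTraceRight, Matrix.of_apply, densityMatrix, Matrix.vecMulVec_apply, Pi.star_apply,
    Finset.sum_mul_sum, mul_assoc]

/-- The average generalized concurrence of `Oψ` for a Haar-random orthogonal matrix `O`. -/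
theorem integral_generalizedConcurrence_haarOrthogonal {α β : Type*} [Fintype α] [Fintype β]
    (e : α × β ≃ κ) (hκ : 1 < Fintype.card κ) (ψ : κ → ℂ) (h1 : ψ ⬝ᵥ star ψ = 1) :
    ∫ O, generalizedConcurrence
        (fun x => (orthogonalGate O : Matrix κ κ ℂ).mulVec ψ (e x)) ∂haarOrthogonal κ =
      2 * (Fintype.card κ + 1 - Fintype.card α - Fintype.card β) *
        (Fintype.card κ - ((ψ ⬝ᵥ ψ) * star (ψ ⬝ᵥ ψ)).re) /
        ((Fintype.card κ - 1) * (Fintype.card κ + 2)) := by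
  classical
  set φ : Matrix.orthogonalGroup κ ℝ → κ → ℂ :=
    fun O => (orthogonalGate O : Matrix κ κ ℂ).mulVec ψ with hφ
  have hc : Continuous φ := continuous_orthogonalGate_mulVec ψ
  have hci : ∀ i, Continuous fun O => φ O i := fun i => (continuous_apply i).comp hc
  obtain ⟨A, B, h⟩ := (isOrthogonalInvariant_haarOrthogonal ψ).exists_eq (quarticMoment_swap _ _)
  have e1 := sum_quarticMoment_norm (haarOrthogonal κ) hc
    fun O => (unitary_mulVec_dotProduct_star _ ψ).trans h1
  have e2 := sum_quarticMoment_square (haarOrthogonal κ) hc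
  simp only [hφ, orthogonalGate_mulVec_dotProduct, integral_const, probReal_univ, one_smul] at e2
  have hint : ∫ O, generalizedConcurrence (fun x => φ O (e x)) ∂haarOrthogonal κ =
      2 * (1 - (∑ a, ∑ a', ∑ b, ∑ b', quarticMoment (haarOrthogonal κ) φ
        (e (a, b)) (e (a', b)) (e (a', b')) (e (a, b'))).re) := by
    simp only [generalizedConcurrence_eq]
    have hI : ∀ {f : Matrix.orthogonalGroup κ ℝ → ℂ}, Continuous f →
        Integrable f (haarOrthogonal κ) := integrable_of_continuous_compactSpace _
    have hS : Integrable (fun O => ∑ a, ∑ a', ∑ b, ∑ b', φ O (e (a, b)) * star (φ O (e (a', b))) *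
        φ O (e (a', b')) * star (φ O (e (a, b')))) (haarOrthogonal κ) := hI (by fun_prop)
    rw [integral_const_mul]
    refine congrArg (2 * ·) ((integral_sub (integrable_const 1) hS.re).trans ?_)
    rw [integral_const, probReal_univ, one_smul]
    congr 1
    refine (integral_re hS).trans (congrArg Complex.re ?_)
    rw [integral_finsetSum _ fun _ _ => hI (by fun_prop)]
    refine Finset.sum_congr rfl fun a _ => ?_
    rw [integral_finsetSum _ fun _ _ => hI (by fun_prop)]
    refine Finset.sum_congr rfl fun a' _ => ?_
    rw [integral_finsetSum _ fun _ _ => hI (by fun_prop)]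
    refine Finset.sum_congr rfl fun b _ => ?_
    rw [integral_finsetSum _ fun _ _ => hI (by fun_prop)]
    rfl
  have hcard : (Fintype.card α * Fintype.card β : ℂ) = Fintype.card κ := by
    rw [← Fintype.card_congr e, Fintype.card_prod]
    push_cast
    rfl
  have hd : (1 : ℝ) < Fintype.card κ := by exact_mod_cast hκ
  have hd1 : (Fintype.card κ : ℝ) - 1 ≠ 0 := by linarith
  have hd2 : (Fintype.card κ : ℝ) + 2 ≠ 0 := by positivity
  set s : ℝ := ((ψ ⬝ᵥ ψ) * star (ψ ⬝ᵥ ψ)).re with hs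
  have hsC : (ψ ⬝ᵥ ψ) * star (ψ ⬝ᵥ ψ) = (s : ℂ) := by
    rw [hs, Complex.star_def, Complex.mul_conj, Complex.ofReal_re]
  rw [hsC] at e2
  have hpur : ∑ a, ∑ a', ∑ b, ∑ b', quarticMoment (haarOrthogonal κ) φ
      (e (a, b)) (e (a', b)) (e (a', b')) (e (a, b')) =
      (((Fintype.card κ - s) * (Fintype.card α + Fintype.card β) +
        s * (Fintype.card κ + 1) - 2) / ((Fintype.card κ - 1) * (Fintype.card κ + 2)) : ℝ) := by
    simp only [hφ, h] at e1 e2 ⊢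
    -- The crossed pairing forces both `a = a'` and `b = b'`, so `B` contributes `d`; the two
    -- pairings with `A` force only one of these equalities each.
    have hB : ∀ (a a' : α) (b b' : β), (if e (a, b) = e (a', b') then
        (if e (a', b) = e (a, b') then (1 : ℂ) else 0) else 0) =
          (if a = a' then 1 else 0) * (if b = b' then 1 else 0) := by
      intro a a' b b'
      by_cases h : a = a' <;> by_cases h' : b = b' <;> simp [h, h']
    simp only [hB]
    simp [Finset.sum_add_distrib] at e1 e2 ⊢
    have hd1' : (Fintype.card κ : ℂ) - 1 ≠ 0 := by exact_mod_cast hd1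
    have hd2' : (Fintype.card κ : ℂ) + 2 ≠ 0 := by exact_mod_cast hd2
    rw [eq_div_iff (mul_ne_zero hd1' hd2')]
    rw [← e2]
    -- Here `s` has been replaced by its contraction, so `A` and `B` need not be solved for: the
    -- norm equation `e1` supplies the remaining constants, and `hcard` turns products of local
    -- dimensions into `d`.
    linear_combination (Fintype.card κ * (Fintype.card α + Fintype.card β) - 2 : ℂ) * e1 +
      (Fintype.card β * A + B + Fintype.card α * A) * (Fintype.card κ - 1) *
        (Fintype.card κ + 2) * hcard
  rw [hint, hpur, Complex.ofReal_re]
  field_simp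
  ring

end OrthogonalAverage

/-! ### Averages over product states and exchange of integrals. -/

section Average

variable {d₁ d₂ d₃ : ℕ}

theorem sum_mul_sum_mul_sum {α β γ R : Type*} [Fintype α] [Fintype β] [Fintype γ] [CommSemiring R]
    (f : α → R) (g : β → R) (h : γ → R) :
    ∑ x : α × β × γ, f x.1 * (g x.2.1 * h x.2.2) = (∑ a, f a) * ((∑ b, g b) * ∑ c, h c) := by
  simp only [Fintype.sum_prod_type, ← Finset.mul_sum, ← Finset.sum_mul]

theorem productState_dotProduct_star (ψ₁ : EuclideanSpace ℂ (Fin d₁))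
    (ψ₂ : EuclideanSpace ℂ (Fin d₂)) (ψ₃ : EuclideanSpace ℂ (Fin d₃)) :
    productState ψ₁ ψ₂ ψ₃ ⬝ᵥ star (productState ψ₁ ψ₂ ψ₃) =
      (ψ₁.ofLp ⬝ᵥ star ψ₁.ofLp) * ((ψ₂.ofLp ⬝ᵥ star ψ₂.ofLp) * (ψ₃.ofLp ⬝ᵥ star ψ₃.ofLp)) := by
  simp only [dotProduct, ← sum_mul_sum_mul_sum]
  refine Finset.sum_congr rfl fun x _ => ?_
  simp only [productState, Pi.star_apply, star_mul']
  ring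

theorem productState_dotProduct (ψ₁ : EuclideanSpace ℂ (Fin d₁))
    (ψ₂ : EuclideanSpace ℂ (Fin d₂)) (ψ₃ : EuclideanSpace ℂ (Fin d₃)) :
    productState ψ₁ ψ₂ ψ₃ ⬝ᵥ productState ψ₁ ψ₂ ψ₃ =
      (ψ₁.ofLp ⬝ᵥ ψ₁.ofLp) * ((ψ₂.ofLp ⬝ᵥ ψ₂.ofLp) * (ψ₃.ofLp ⬝ᵥ ψ₃.ofLp)) := by
  simp only [dotProduct, ← sum_mul_sum_mul_sum]
  refine Finset.sum_congr rfl fun x _ => ?_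
  simp only [productState]
  ring

theorem integral_square_productState [NeZero d₁] [NeZero d₂] [NeZero d₃] :
    ∫ ψ, ((productState ψ.1.1 ψ.2.1.1 ψ.2.2.1 ⬝ᵥ productState ψ.1.1 ψ.2.1.1 ψ.2.2.1) *
        star (productState ψ.1.1 ψ.2.1.1 ψ.2.2.1 ⬝ᵥ productState ψ.1.1 ψ.2.1.1 ψ.2.2.1)).re
      ∂((uniformSphere d₁).prod ((uniformSphere d₂).prod (uniformSphere d₃))) =
      8 / ((d₁ + 1) * (d₂ + 1) * (d₃ + 1)) := by
  have h : ∫ ψ, (productState ψ.1.1 ψ.2.1.1 ψ.2.2.1 ⬝ᵥ productState ψ.1.1 ψ.2.1.1 ψ.2.2.1) *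
        star (productState ψ.1.1 ψ.2.1.1 ψ.2.2.1 ⬝ᵥ productState ψ.1.1 ψ.2.1.1 ψ.2.2.1)
      ∂((uniformSphere d₁).prod ((uniformSphere d₂).prod (uniformSphere d₃))) =
      ((8 / ((d₁ + 1) * (d₂ + 1) * (d₃ + 1)) : ℝ) : ℂ) := by
    have e : ∀ a b c : ℂ, a * (b * c) * star (a * (b * c)) =
        a * star a * (b * star b * (c * star c)) := fun a b c => by
      rw [star_mul', star_mul']
      ring
    simp only [productState_dotProduct, e]
    rw [integral_prod_mul (fun x : Metric.sphere (0 : EuclideanSpace ℂ (Fin d₁)) 1 =>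
        (x.1.ofLp ⬝ᵥ x.1.ofLp) * star (x.1.ofLp ⬝ᵥ x.1.ofLp))
      (fun y : Metric.sphere (0 : EuclideanSpace ℂ (Fin d₂)) 1 ×
          Metric.sphere (0 : EuclideanSpace ℂ (Fin d₃)) 1 =>
        (y.1.1.ofLp ⬝ᵥ y.1.1.ofLp) * star (y.1.1.ofLp ⬝ᵥ y.1.1.ofLp) *
          ((y.2.1.ofLp ⬝ᵥ y.2.1.ofLp) * star (y.2.1.ofLp ⬝ᵥ y.2.1.ofLp))),
      integral_prod_mul (fun x : Metric.sphere (0 : EuclideanSpace ℂ (Fin d₂)) 1 =>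
        (x.1.ofLp ⬝ᵥ x.1.ofLp) * star (x.1.ofLp ⬝ᵥ x.1.ofLp))
      (fun x : Metric.sphere (0 : EuclideanSpace ℂ (Fin d₃)) 1 =>
        (x.1.ofLp ⬝ᵥ x.1.ofLp) * star (x.1.ofLp ⬝ᵥ x.1.ofLp)),
      integral_square_uniformSphere, integral_square_uniformSphere, integral_square_uniformSphere]
    push_cast
    rw [div_mul_div_comm, div_mul_div_comm]
    norm_num [mul_assoc]
  have hi : Integrable (fun ψ => (productState ψ.1.1 ψ.2.1.1 ψ.2.2.1 ⬝ᵥ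
        productState ψ.1.1 ψ.2.1.1 ψ.2.2.1) *
        star (productState ψ.1.1 ψ.2.1.1 ψ.2.2.1 ⬝ᵥ productState ψ.1.1 ψ.2.1.1 ψ.2.2.1))
      ((uniformSphere d₁).prod ((uniformSphere d₂).prod (uniformSphere d₃))) := by
    refine integrable_of_continuous_compactSpace _ ?_
    unfold productState dotProduct
    fun_prop
  exact (integral_re hi).trans ((congrArg Complex.re h).trans (Complex.ofReal_re _))

theorem continuous_generalizedConcurrence {α β : Type*} [Fintype α] [Fintype β] :
    Continuous (generalizedConcurrence : (α × β → ℂ) → ℝ) := by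
  have : (generalizedConcurrence : (α × β → ℂ) → ℝ) = fun ψ => 2 * (1 - (∑ a, ∑ a', ∑ b, ∑ b',
      ψ (a, b) * star (ψ (a', b)) * ψ (a', b') * star (ψ (a, b'))).re) :=
    funext generalizedConcurrence_eq
  rw [this]
  refine continuous_const.mul (continuous_const.sub (Complex.continuous_re.comp ?_))
  fun_prop

theorem continuous_gate_productState :
    Continuous fun p : Matrix.orthogonalGroup (TriIndex d₁ d₂ d₃) ℝ ×
        (Metric.sphere (0 : EuclideanSpace ℂ (Fin d₁)) 1 ×
          Metric.sphere (0 : EuclideanSpace ℂ (Fin d₂)) 1 ×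
          Metric.sphere (0 : EuclideanSpace ℂ (Fin d₃)) 1) =>
      (orthogonalGate p.1 : Matrix (TriIndex d₁ d₂ d₃) (TriIndex d₁ d₂ d₃) ℂ).mulVec
        (productState p.2.1.1 p.2.2.1.1 p.2.2.2.1) := by
  refine (continuous_orthogonalGate.comp continuous_fst).matrix_mulVec ?_
  unfold productState
  fun_prop

/-- Fubini for a continuous function on a compact product; it makes the Haar average the inner
integral, where the state is fixed. -/
theorem averageEntanglingPower_eq_integral [NeZero d₁] [NeZero d₂] [NeZero d₃]
    {τ : (TriIndex d₁ d₂ d₃ → ℂ) → ℝ} (hτ : Continuous τ) :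
    averageEntanglingPower τ =
      ∫ ψ, ∫ O, τ ((orthogonalGate O : Matrix (TriIndex d₁ d₂ d₃) (TriIndex d₁ d₂ d₃) ℂ).mulVec
        (productState ψ.1.1 ψ.2.1.1 ψ.2.2.1)) ∂haarOrthogonal (TriIndex d₁ d₂ d₃)
      ∂((uniformSphere d₁).prod ((uniformSphere d₂).prod (uniformSphere d₃))) := by
  unfold averageEntanglingPower entanglingPower
  have hc := hτ.comp (continuous_gate_productState (d₁ := d₁) (d₂ := d₂) (d₃ := d₃))
  exact integral_integral_swap_of_hasCompactSupport 
    (f := fun (O : Matrix.orthogonalGroup (TriIndex d₁ d₂ d₃) ℝ)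
      (ψ : Metric.sphere (0 : EuclideanSpace ℂ (Fin d₁)) 1 ×
        Metric.sphere (0 : EuclideanSpace ℂ (Fin d₂)) 1 ×
        Metric.sphere (0 : EuclideanSpace ℂ (Fin d₃)) 1) =>
    τ ((orthogonalGate O : Matrix (TriIndex d₁ d₂ d₃) (TriIndex d₁ d₂ d₃) ℂ).mulVec
      (productState ψ.1.1 ψ.2.1.1 ψ.2.2.1))) hc (HasCompactSupport.of_compactSpace _)

/-- The average entangling power of the generalized concurrence of a bipartition. -/
theorem averageEntanglingPower_generalizedConcurrence [NeZero d₁] [NeZero d₂] [NeZero d₃]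
    {α β : Type*} [Fintype α] [Fintype β] (e : α × β ≃ TriIndex d₁ d₂ d₃) {a b d : ℕ}
    (ha : Fintype.card α = a) (hb : Fintype.card β = b) (hd : d = d₁ * d₂ * d₃) (h1 : 1 < d) :
    averageEntanglingPower (fun ψ : TriIndex d₁ d₂ d₃ → ℂ =>
        generalizedConcurrence fun x => ψ (e x)) =
      2 * (d + 1 - a - b) * (d - 8 / ((d₁ + 1) * (d₂ + 1) * (d₃ + 1))) /
        ((d - 1) * (d + 2)) := by
  have hcard : Fintype.card (TriIndex d₁ d₂ d₃) = d := by
    simp [hd, mul_assoc]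
  have hτ : Continuous fun ψ : TriIndex d₁ d₂ d₃ → ℂ => generalizedConcurrence fun x => ψ (e x) :=
    continuous_generalizedConcurrence.comp (by fun_prop)
  rw [averageEntanglingPower_eq_integral hτ]
  have key := fun ψ : (Metric.sphere (0 : EuclideanSpace ℂ (Fin d₁)) 1 ×
          Metric.sphere (0 : EuclideanSpace ℂ (Fin d₂)) 1 ×
          Metric.sphere (0 : EuclideanSpace ℂ (Fin d₃)) 1) =>
    integral_generalizedConcurrence_haarOrthogonal e (hcard ▸ h1)
      (productState ψ.1.1 ψ.2.1.1 ψ.2.2.1)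
      (by simp only [productState_dotProduct_star, sphere_dotProduct_star, mul_one])
  simp only [key]
  rw [integral_div, integral_const_mul, integral_sub (integrable_const _), integral_const,
    probReal_univ, one_smul, integral_square_productState, hcard, ha, hb]
  refine integrable_of_continuous_compactSpace _ ?_
  unfold productState dotProduct
  fun_prop

theorem integrable_gate_productState [NeZero d₁] [NeZero d₂] [NeZero d₃]
    {τ : (TriIndex d₁ d₂ d₃ → ℂ) → ℝ} (hτ : Continuous τ)
    (O : Matrix.orthogonalGroup (TriIndex d₁ d₂ d₃) ℝ) :
    Integrable (fun ψ => τ ((orthogonalGate O :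
        Matrix (TriIndex d₁ d₂ d₃) (TriIndex d₁ d₂ d₃) ℂ).mulVec
      (productState ψ.1.1 ψ.2.1.1 ψ.2.2.1)))
      ((uniformSphere d₁).prod ((uniformSphere d₂).prod (uniformSphere d₃))) :=
  integrable_of_continuous_compactSpace _
    (hτ.comp (continuous_gate_productState.comp (by fun_prop : Continuous fun ψ => (O, ψ))))

theorem integrable_entanglingPower [NeZero d₁] [NeZero d₂] [NeZero d₃]
    {τ : (TriIndex d₁ d₂ d₃ → ℂ) → ℝ} (hτ : Continuous τ) :
    Integrable (fun O => entanglingPower τ (orthogonalGate O))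
      (haarOrthogonal (TriIndex d₁ d₂ d₃)) := by
  refine integrable_of_continuous_compactSpace _ ?_
  -- Continuity of the parametric integral in `O` is a sequential argument, so the group must be
  -- first countable.
  have : FirstCountableTopology (Matrix (TriIndex d₁ d₂ d₃) (TriIndex d₁ d₂ d₃) ℝ) :=
    inferInstanceAs (FirstCountableTopology (TriIndex d₁ d₂ d₃ → TriIndex d₁ d₂ d₃ → ℝ))
  have : FirstCountableTopology (Matrix.orthogonalGroup (TriIndex d₁ d₂ d₃) ℝ) :=
    Topology.IsInducing.subtypeVal.firstCountableTopology
  have h := continuous_parametric_integral_of_continuous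
    (μ := (uniformSphere d₁).prod ((uniformSphere d₂).prod (uniformSphere d₃)))
    (f := fun (O : Matrix.orthogonalGroup (TriIndex d₁ d₂ d₃) ℝ) ψ =>
      τ ((orthogonalGate O : Matrix (TriIndex d₁ d₂ d₃) (TriIndex d₁ d₂ d₃) ℂ).mulVec
        (productState ψ.1.1 ψ.2.1.1 ψ.2.2.1)))
    (hτ.comp continuous_gate_productState) isCompact_univ
  simpa only [entanglingPower, Measure.restrict_univ] using h

theorem integral_add_add {Ω : Type*} [MeasurableSpace Ω] {μ : Measure Ω} {f g h : Ω → ℝ}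
    (hf : Integrable f μ) (hg : Integrable g μ) (hh : Integrable h μ) :
    ∫ ω, f ω + g ω + h ω ∂μ = ∫ ω, f ω ∂μ + ∫ ω, g ω ∂μ + ∫ ω, h ω ∂μ :=
  (integral_add (hf.add hg) hh).trans (congrArg (· + _) (integral_add hf hg))

theorem averageEntanglingPower_oneTangle [NeZero d₁] [NeZero d₂] [NeZero d₃] :
    averageEntanglingPower (oneTangle (d₁ := d₁) (d₂ := d₂) (d₃ := d₃)) = 1 / 3 *
      (averageEntanglingPower (concurrence12_3 (d₁ := d₁) (d₂ := d₂) (d₃ := d₃)) +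
        averageEntanglingPower (concurrence13_2 (d₁ := d₁) (d₂ := d₂) (d₃ := d₃)) +
        averageEntanglingPower (concurrence23_1 (d₁ := d₁) (d₂ := d₂) (d₃ := d₃))) := by
  have c3 : Continuous (concurrence12_3 (d₁ := d₁) (d₂ := d₂) (d₃ := d₃)) :=
    continuous_generalizedConcurrence.comp (by fun_prop)
  have c2 : Continuous (concurrence13_2 (d₁ := d₁) (d₂ := d₂) (d₃ := d₃)) :=
    continuous_generalizedConcurrence.comp (by fun_prop)
  have c1 : Continuous (concurrence23_1 (d₁ := d₁) (d₂ := d₂) (d₃ := d₃)) :=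
    continuous_generalizedConcurrence.comp (by fun_prop)
  have h : ∀ O : Matrix.orthogonalGroup (TriIndex d₁ d₂ d₃) ℝ,
      entanglingPower oneTangle (orthogonalGate O) = 1 / 3 *
        (entanglingPower concurrence12_3 (orthogonalGate O) +
          entanglingPower concurrence13_2 (orthogonalGate O) +
          entanglingPower concurrence23_1 (orthogonalGate O)) := by
    intro O
    have i3 := integrable_gate_productState c3 O
    have i2 := integrable_gate_productState c2 O
    have i1 := integrable_gate_productState c1 O
    simp only [entanglingPower, oneTangle]
    rw [integral_const_mul, integral_add_add i3 i2 i1]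
  unfold averageEntanglingPower
  simp only [h]
  have j3 := integrable_entanglingPower c3
  have j2 := integrable_entanglingPower c2
  rw [integral_const_mul, integral_add_add j3 j2 (integrable_entanglingPower c1)]

end Average

theorem mainTheorem2 (d₁ d₂ d₃ d : ℕ) (hd : d = d₁ * d₂ * d₃) (hd_one : 1 < d) :
    averageEntanglingPower (d₁ := d₁) (d₂ := d₂) (d₃ := d₃) oneTangle =
        ((3 * d + 3 - d₁ - d₂ - d₃ - d₁ * d₂ - d₁ * d₃ - d₂ * d₃) *
            (d * ((d₁ + 1) * (d₂ + 1) * (d₃ + 1)) - 8)) /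
          ((3 / 2 : ℝ) * (d - 1) * (d + 2) * ((d₁ + 1) * (d₂ + 1) * (d₃ + 1))) ∧
      (d₁ = d₂ → d₂ = d₃ →
        averageEntanglingPower (d₁ := d₁) (d₂ := d₂) (d₃ := d₃) oneTangle =
          averageEntanglingPower (d₁ := d₁) (d₂ := d₂) (d₃ := d₃) concurrence12_3) := by
  have : NeZero d₁ := ⟨by rintro rfl; simp at hd; omega⟩
  have : NeZero d₂ := ⟨by rintro rfl; simp at hd; omega⟩
  have : NeZero d₃ := ⟨by rintro rfl; simp at hd; omega⟩
  -- Each concurrence is definitionally the bipartite one precomposed with a relabelling of the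
  -- basis; the right-hand side is read off by unification.
  have h3 : averageEntanglingPower (concurrence12_3 (d₁ := d₁) (d₂ := d₂) (d₃ := d₃)) = _ :=
    averageEntanglingPower_generalizedConcurrence
      (⟨fun x => (x.1.1, x.1.2, x.2), fun x => ((x.1, x.2.1), x.2.2), fun _ => rfl, fun _ => rfl⟩ :
        (Fin d₁ × Fin d₂) × Fin d₃ ≃ TriIndex d₁ d₂ d₃)
      (a := d₁ * d₂) (b := d₃) (by simp) (by simp) hd hd_one
  have h2 : averageEntanglingPower (concurrence13_2 (d₁ := d₁) (d₂ := d₂) (d₃ := d₃)) = _ :=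
    averageEntanglingPower_generalizedConcurrence
      (⟨fun x => (x.1.1, x.2, x.1.2), fun x => ((x.1, x.2.2), x.2.1), fun _ => rfl, fun _ => rfl⟩ :
        (Fin d₁ × Fin d₃) × Fin d₂ ≃ TriIndex d₁ d₂ d₃)
      (a := d₁ * d₃) (b := d₂) (by simp) (by simp) hd hd_one
  have h1 : averageEntanglingPower (concurrence23_1 (d₁ := d₁) (d₂ := d₂) (d₃ := d₃)) = _ :=
    averageEntanglingPower_generalizedConcurrence
      (⟨fun x => (x.2, x.1.1, x.1.2), fun x => ((x.2.1, x.2.2), x.1), fun _ => rfl, fun _ => rfl⟩ :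
        (Fin d₂ × Fin d₃) × Fin d₁ ≃ TriIndex d₁ d₂ d₃)
      (a := d₂ * d₃) (b := d₁) (by simp) (by simp) hd hd_one
  rw [averageEntanglingPower_oneTangle, h1, h2, h3]
  constructor
  · have hd1 : (d : ℝ) - 1 ≠ 0 := by
      have : (1 : ℝ) < d := by exact_mod_cast hd_one
      linarith
    push_cast
    field_simp
    ring
  -- For equal dimensions the three bipartite averages have the same value, so their mean is any one
  -- of them.
  · rintro rfl rfl
    ring
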